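/- \textbf{Setting.} Let $\mathcal C$ be a CSS code on $n$ qubits given by $n_x$ $X$-type and $n_z$ $Z$-type stabilizers (checks), not necessarily independent, with $n_x+n_z=n$. Check $S_c$ acts on distinct data qubits in a fixed order $q_{c,1},\dots,q_{c,m_c}$ ($m_c\ge 1$), and the first qubits $q_{c,1}$ of all $n$ checks are distinct. \textbf{Hook-error distance.} For an $X$-check $c$ and $0\le t\le m_c$ let $H_{c,t}=\prod_{j=1}^{t}X_{q_{c,j}}$; for a $Z$-check use $Z$ instead of $X$. The hook-error distance $d_h$ is the largest $d$ such that, for each of the two types, no product of $n_h$ hook errors $H_{c,t}$ and $n_p$ single-qubit Pauli errors, all of that type, with $n_h+n_p<d$ is a nontrivial logical operator (an operator commuting with all checks that is not a product of checks). It exists if the code encodes at least one qubit; otherwise put $d_h=0$. \textbf{Circuit.} Each check $c$ has an ancilla site $a_c$. A cycle of the Mid-SWAP circuit: (1) prepare a fresh atom on every ancilla site, in $|+\rangle$ for $X$-checks and in $|0\rangle$ for $Z$-checks; (2) for each $X$-check apply $CNOT(a_c,q_{c,1})$, $SWAP(a_c,q_{c,1})$, $CNOT(a_c,q_{c,2}),\dots,CNOT(a_c,q_{c,m_c})$,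 check after check; (3) for each $Z$-check do the same with the $CNOT$s reversed (data qubit as control); (4) measure all ancillas, in the $X$ basis for $X$-checks and in the $Z$ basis for $Z$-checks. In the memory experiment in basis $B\in\{X,Z\}$ with $R\ge 0$ cycles, all data qubits are prepared in the $+1$ eigenstate of $B$, $R$ cycles are run, and all data qubits are measured in basis $B$. The detectors are the parities of consecutive values of the same check: for checks of type $B$ the values are the initial deterministic one, the $R$ ancilla results, and the parity of the final data results on the check; for checks of the other type only the $R$ ancilla results. The observables are the results for all logical operators of type $B$, computed from the final data results. \textbf{Atom loss.} A loss configuration is a finite set of space-time locations (a time between two consecutive operations, and a site); the atom on that site at that time is lost. All later $CNOT$s involving a lost atom are removed; a $SWAP$ is atom shuttling and moves lost atoms (empty traps) along; the preparation of a site replaces its atom. Without loss-resolving readouts, measuring a lost atom just reports a bit, which may be $0$ or $1$. \textbf{Theorem (tolerance to atom loss without loss-resolving readouts).} The Mid-SWAP syndrome extraction circuit of $\mathcal C$ corrects $\max\{0,\lfloor (d_h-1)/2\rfloor\}$ atom losses without loss-resolving readouts. That is, for each basis $B$ and each number $R$ of cycles there is a decoder, a function from detector patterns to values of the observables, that predicts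 all observables correctly for every loss configuration with at most $\max\{0,\lfloor (d_h-1)/2\rfloor\}$ losses and for every outcome that has positive probability under it. -/

import Mathlib

open scoped Classical

noncomputable section

namespace MidSwap

/-- The two Pauli bases. -/
inductive Basis where
  | X
  | Z

/-! ### Circuits with atom loss -/

/-- Circuit operations on sites `σ`, with measurement results stored under labels `μ`.
`prep X s` puts a fresh atom in state `|+⟩` on site `s`, and `prep Z s` one in state `|0⟩`
(whatever was on the site is discarded). `cnot c t` has control `c` and target `t`.
`swap s s'` exchanges the two atoms (atom shuttling).
`meas B s m` measures the atom on site `s` in basis `B` and stores the result under `m`. -/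
inductive Op (σ μ : Type) where
  | prep (B : Basis) (s : σ)
  | cnot (c t : σ)
  | swap (s s' : σ)
  | meas (B : Basis) (s : σ) (m : μ)

/-- An (unnormalized) state vector of one qubit per site, in the computational basis. -/
abbrev State (σ : Type) := (σ → ZMod 2) → ℂ

/-- Kraus operators of the preparation of a site:
`|0⟩⟨b|` for the basis `Z` and `|+⟩⟨b|` for the basis `X`, with `b` ranging over the two bits. -/
def prepKraus {σ : Type} (B : Basis) (s : σ) (b : ZMod 2) (ψ : State σ) : State σ :=
  match B with
  | .Z => fun x => if x s = 0 then ψ (Function.update x s b) else 0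
  | .X => fun x => ((Real.sqrt 2 : ℝ) : ℂ)⁻¹ * ψ (Function.update x s b)

/-- The gate `CNOT` with control `c` and target `t`. -/
def cnotGate {σ : Type} (c t : σ) (ψ : State σ) : State σ :=
  fun x => ψ (Function.update x t (x t + x c))

/-- Exchange of the qubits on two sites. -/
def swapGate {σ : Type} (s s' : σ) (ψ : State σ) : State σ :=
  fun x => ψ (x ∘ Equiv.swap s s')

/-- Projection of site `s` onto the result `b` of a measurement in a basis:
`|b⟩⟨b|` for the basis `Z`, and `(1 + (-1)^b X) / 2` for the basis `X`. -/
def measProj {σ : Type} (B : Basis) (s : σ) (b : ZMod 2) (ψ : State σ) : State σ :=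
  match B with
  | .Z => fun x => if x s = b then ψ x else 0
  | .X => fun x => (1 / 2 : ℂ) * (ψ x + (-1) ^ b.val * ψ (Function.update x s (x s + 1)))

/-- `CanYield l ops k ψ lost r`: the operations `ops`, the first of which is number `k` of the
circuit, when started in state `ψ` with the atoms on the sites `lost` already lost, yield the
measurement record `r` with positive probability under the loss configuration `l`.

A pair `(k, s)` in `l` says that the atom on site `s` is lost just before operation number `k`.
A `CNOT` that involves a lost atom is removed. Shuttling moves lost atoms (empty traps) like any
others. A preparation brings in a fresh atom. The measurement of a lost atom
does not reveal the loss: it reports a bit, which can be either one. The qubit of a lost atom is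
kept in the state vector, but nothing acts on it until it is discarded, so that it is traced out. -/
def CanYield {σ μ : Type} (l : Finset (ℕ × σ)) :
    List (Op σ μ) → ℕ → State σ → Set σ → (μ → ZMod 2) → Prop
  | [], _, ψ, _, _ => ψ ≠ 0
  | .prep B s :: ops, k, ψ, lost, r =>
      ∃ b : ZMod 2, CanYield l ops (k + 1) (prepKraus B s b ψ)
        ((lost ∪ {u | (k, u) ∈ l}) \ {s}) r
  | .cnot c t :: ops, k, ψ, lost, r =>
      CanYield l ops (k + 1)
        (if c ∈ lost ∪ {u | (k, u) ∈ l} ∨ t ∈ lost ∪ {u | (k, u) ∈ l} then ψ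
          else cnotGate c t ψ)
        (lost ∪ {u | (k, u) ∈ l}) r
  | .swap s s' :: ops, k, ψ, lost, r =>
      CanYield l ops (k + 1) (swapGate s s' ψ)
        {v | Equiv.swap s s' v ∈ lost ∪ {u | (k, u) ∈ l}} r
  | .meas B s m :: ops, k, ψ, lost, r =>
      CanYield l ops (k + 1)
        (if s ∈ lost ∪ {u | (k, u) ∈ l} then ψ else measProj B s (r m) ψ)
        (lost ∪ {u | (k, u) ∈ l}) r

/-! ### CSS codes with ordered checks -/

/-- The Pauli operator (of one fixed type) that acts on the qubits of the list `L`,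
as a vector over the field with two elements. -/
def pauliVec {n : ℕ} (L : List (Fin n)) : Fin n → ZMod 2 :=
  (L.map fun q => Pi.single q 1).sum

/-- Type of a check: checks in `Fin nX` are of type `X`, those in `Fin nZ` of type `Z`. -/
def checkType {nX nZ : ℕ} : Fin nX ⊕ Fin nZ → Basis :=
  Sum.elim (fun _ => .X) (fun _ => .Z)

/-- A CSS code on `n` qubits given by `nX` checks of type `X` and `nZ` of type `Z` (not necessarily
independent), `nX + nZ = n`. The check `c` acts on the distinct qubits
`first c :: rest c`, in this order, and no two checks have the same first qubit. -/
structure Code (n nX nZ : ℕ) where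
  first : Fin nX ⊕ Fin nZ → Fin n
  rest : Fin nX ⊕ Fin nZ → List (Fin n)
  nodup : ∀ c, (first c :: rest c).Nodup
  commute : ∀ (i : Fin nX) (j : Fin nZ),
    pauliVec (first (.inl i) :: rest (.inl i)) ⬝ᵥ pauliVec (first (.inr j) :: rest (.inr j)) = 0
  count : nX + nZ = n
  first_injective : Function.Injective first

namespace Code

variable {n nX nZ : ℕ} (C : Code n nX nZ)

/-- The ordered list of qubits on which a check acts. -/
def support (c : Fin nX ⊕ Fin nZ) : List (Fin n) := C.first c :: C.rest c

/-- The hook error `H_{c,t}`: the Pauli of the type of `c` on the first `t` qubits of `c`. -/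
def hook (c : Fin nX ⊕ Fin nZ) (t : ℕ) : Fin n → ZMod 2 := pauliVec ((C.support c).take t)

/-- The Pauli operator of type `B` with vector `v` commutes with all checks of the other type. -/
def IsLogical (B : Basis) (v : Fin n → ZMod 2) : Prop :=
  ∀ c, checkType c ≠ B → pauliVec (C.support c) ⬝ᵥ v = 0

/-- The Pauli operator of type `B` with vector `v` is a nontrivial logical operator:
it commutes with all checks but is not a product of checks. -/
def IsNontrivialLogical (B : Basis) (v : Fin n → ZMod 2) : Prop :=
  C.IsLogical B v ∧
    v ∉ Submodule.span (ZMod 2) {w | ∃ c, checkType c = B ∧ w = pauliVec (C.support c)}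

/-- No product of fewer than `d` hook errors and single-qubit Pauli errors, all of the same type,
is a nontrivial logical operator. -/
def ToleratesHooks (d : ℕ) : Prop :=
  ∀ (B : Basis) (hooks : List ((Fin nX ⊕ Fin nZ) × ℕ)) (paulis : List (Fin n)),
    (∀ h ∈ hooks, checkType h.1 = B) → hooks.length + paulis.length < d →
      ¬ C.IsNontrivialLogical B ((hooks.map fun h => C.hook h.1 h.2).sum + pauliVec paulis)

/-- The hook-error distance: the largest `d` with `ToleratesHooks d`. A largest one exists, and is
at least 1, if the code has a nontrivial logical operator, that is, encodes at least one qubit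
(otherwise the value is 0). -/
def hookDistance : ℕ := sSup {d | C.ToleratesHooks d}

/-! ### The Mid-SWAP syndrome extraction circuit -/

end Code

/-- Sites: one for each data qubit, and one ancilla for each check. -/
abbrev Site (n nX nZ : ℕ) := Fin n ⊕ (Fin nX ⊕ Fin nZ)

/-- Labels of measurements: the ancilla of a check in a given cycle, or a data qubit at the end. -/
abbrev Label (n nX nZ : ℕ) := (ℕ × (Fin nX ⊕ Fin nZ)) ⊕ Fin n

/-- The list of all checks: first those of type `X`, then those of type `Z`. -/
def allChecks (nX nZ : ℕ) : List (Fin nX ⊕ Fin nZ) :=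
  (List.finRange nX).map Sum.inl ++ (List.finRange nZ).map Sum.inr

namespace Code

variable {n nX nZ : ℕ} (C : Code n nX nZ)

/-- The `CNOT` between the ancilla of the check `c` and the data qubit `q`: the ancilla is the
control for a check of type `X`, and the target for one of type `Z`. -/
def checkCnot (c : Fin nX ⊕ Fin nZ) (q : Fin n) : Op (Site n nX nZ) (Label n nX nZ) :=
  match checkType c with
  | .X => .cnot (.inr c) (.inl q)
  | .Z => .cnot (.inl q) (.inr c)

/-- The gates of one check: the `CNOT`s with its qubits in their order, and between the
first one and the second one a `SWAP` of the ancilla with the first qubit. -/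
def checkBlock (c : Fin nX ⊕ Fin nZ) : List (Op (Site n nX nZ) (Label n nX nZ)) :=
  checkCnot c (C.first c) :: .swap (.inr c) (.inl (C.first c)) :: (C.rest c).map (checkCnot c)

/-- Cycle number `k` of the Mid-SWAP circuit: prepare all ancillas with fresh atoms, apply the gates
of the `X` checks and then those of the `Z` checks, and measure all ancillas. -/
def cycle (k : ℕ) : List (Op (Site n nX nZ) (Label n nX nZ)) :=
  (allChecks nX nZ).map (fun c => .prep (checkType c) (.inr c)) ++
  (allChecks nX nZ).flatMap C.checkBlock ++
  (allChecks nX nZ).map (fun c => .meas (checkType c) (.inr c) (.inl (k, c)))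

/-- The memory experiment in basis `B` with `R` cycles: prepare all data qubits in basis `B`, run
`R` cycles, and measure all data qubits in basis `B`. -/
def memory (B : Basis) (R : ℕ) : List (Op (Site n nX nZ) (Label n nX nZ)) :=
  (List.finRange n).map (fun q => .prep B (.inl q)) ++
  (List.range R).flatMap C.cycle ++
  (List.finRange n).map (fun q => .meas B (.inl q) (.inr q))

/-- The record `r` occurs with positive probability in the memory experiment under the loss
configuration `l`. (All sites are prepared before they are used, so that the state
before the first preparations is immaterial.) -/
def IsOutcome (B : Basis) (R : ℕ) (l : Finset (ℕ × Site n nX nZ))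
    (r : Label n nX nZ → ZMod 2) : Prop :=
  CanYield l (C.memory B R) 0 (Pi.single 0 1) ∅ r

/-- Successive values of the check `c`: value `0` is the one fixed by the preparation of the data
(used for checks of type `B` only), values `1, …, R` are the ancilla results of the `R` cycles, and
value `R + 1` is computed from the final data results (used for checks of type `B` only). -/
def checkValue (R : ℕ) (r : Label n nX nZ → ZMod 2) (c : Fin nX ⊕ Fin nZ) : ℕ → ZMod 2
  | 0 => 0
  | k + 1 => if k < R then r (.inl (k, c)) else ((C.support c).map fun q => r (.inr q)).sum

/-- The detectors: sums of any two consecutive available values of a check. For a check of type `B`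
the values `0, …, R + 1` are available, for a check of the other type the values `1, …, R`. (Entries
outside these ranges are filled with zeros.) -/
def detectors (B : Basis) (R : ℕ) (r : Label n nX nZ → ZMod 2) (c : Fin nX ⊕ Fin nZ) (k : ℕ) :
    ZMod 2 :=
  if (checkType c = B ∧ k ≤ R) ∨ (1 ≤ k ∧ k + 1 ≤ R) then
    C.checkValue R r c k + C.checkValue R r c (k + 1)
  else 0

/-- The observables: the results for all logical operators of type `B`, computed from the final
data results. Without any loss they are all `0`. -/
def observables (B : Basis) (r : Label n nX nZ → ZMod 2)
    (v : {v : Fin n → ZMod 2 // C.IsLogical B v}) : ZMod 2 :=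
  ∑ q, v.1 q * r (.inr q)

/-- The Mid-SWAP circuit corrects `t` atom losses without loss-resolving readouts: in the memory
experiment in either basis and with any number of cycles, some decoder, which sees only the
detectors, predicts all observables, whatever the loss configuration with at most `t` losses and
whatever the outcome. -/
def CorrectsLosses (t : ℕ) : Prop :=
  ∀ (B : Basis) (R : ℕ),
    ∃ decoder : ((Fin nX ⊕ Fin nZ) → ℕ → ZMod 2) →
        ({v : Fin n → ZMod 2 // C.IsLogical B v} → ZMod 2),
      ∀ l : Finset (ℕ × Site n nX nZ), l.card ≤ t →
        ∀ r, C.IsOutcome B R l r → decoder (C.detectors B R r) = C.observables B r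

end Code

end MidSwap

end

noncomputable section

namespace MidSwap

/-! In the basis `B` of the experiment every operation acts on bit strings: a `CNOT` is linear, a
preparation in `B` resets a value to 0, and a preparation or measurement in the other basis leaves
the value arbitrary. Walking backwards from a nonzero final amplitude shows that each possible
outcome is the record of such a classical trajectory (`exists_run_of_canYield`). The rest is linear
algebra over the field with two elements.

Along a trajectory the data vector stays in a space `V` spanned by the checks of the type opposite
to `B` and at most one elementary error per loss (`triple_memory`). A check of type `B` only reads
data into its ancilla, and its swap exchanges equal values, up to errors already in `V`. The ancilla
of an opposite check carries some value `a`; after `t` gates the data vector is, modulo `V`, `a`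
times the hook error `H_{c,t}`, and at the end this hook is a full check. If the ancilla is lost
after `t` gates, the later gates drop out and `H_{c,t}` is put into `V`. A lost data atom, or an
ancilla lost before the swap that makes it a data atom, costs one unit vector. A lost data atom
swapped to the ancilla site leaves behind only `H_{c,1}`, the same unit vector, so each loss is
charged once.

For two outcomes with at most `t` losses each and equal detectors, the detectors telescope to equal
final check parities. The difference of the final data thus commutes with the checks of type `B` and
is, up to checks, a product of at most `2t` elementary errors. By the hook-error distance it is a
product of checks (`ToleratesHooks.mem_gauge`), which no observable sees. So any outcome compatible
with the detectors decodes correctly. -/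

/-- The basis of the other type. -/
def Basis.other : Basis → Basis
  | .X => .Z
  | .Z => .X

/-- The sign character of the field with two elements. -/
def sgn (a : ZMod 2) : ℂ := (-1) ^ a.val

theorem zmod_two_cases (a : ZMod 2) : a = 0 ∨ a = 1 := by
  revert a; decide

@[simp] theorem sgn_zero : sgn 0 = 1 := by simp [sgn]

@[simp] theorem sgn_one : sgn 1 = -1 := by
  have : (1 : ZMod 2).val = 1 := rfl
  simp [sgn, this]

theorem sgn_add (a b : ZMod 2) : sgn (a + b) = sgn a * sgn b := by
  have h : (1 : ZMod 2) + 1 = 0 := rfl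
  rcases zmod_two_cases a with rfl | rfl <;> rcases zmod_two_cases b with rfl | rfl <;> simp [h]

section

variable {σ : Type}

/-- Adding one to the value on a site. -/
def flip (s : σ) (x : σ → ZMod 2) : σ → ZMod 2 := x + Pi.single s 1

theorem update_add_one (s : σ) (x : σ → ZMod 2) :
    Function.update x s (x s + 1) = flip s x := by
  ext u
  by_cases h : u = s
  · subst h; simp [flip]
  · simp [flip, h]

theorem flip_flip (s : σ) (x : σ → ZMod 2) : flip s (flip s x) = x := by
  ext u
  simp [flip, add_assoc, CharTwo.add_self_eq_zero]

theorem flip_of_ne {s u : σ} (h : u ≠ s) (x : σ → ZMod 2) : flip s x u = x u := by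
  simp [flip, h]

@[simp] theorem flip_self (s : σ) (x : σ → ZMod 2) : flip s x s = x s + 1 := by
  simp [flip]

/-- Projection of the site `s` onto the computational value `b`. -/
theorem proj_eq (s : σ) (b : ZMod 2) (ψ : State σ) (y : σ → ZMod 2) :
    (if y s = b then ψ y else 0) = (1 / 2 : ℂ) * (ψ y + sgn b * (sgn (y s) * ψ y)) := by
  rcases zmod_two_cases b with rfl | rfl <;> rcases zmod_two_cases (y s) with h | h <;>
    simp [h] <;> ring

/-- Discarding the old atom projects onto `b`, and a flip then turns the value 1 into 0. Both
factors have simple Fourier transforms. -/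
theorem prepKraus_Z (s : σ) (b : ZMod 2) (ψ : State σ) (y : σ → ZMod 2) :
    prepKraus .Z s b ψ y =
      (fun z => if z s = b then ψ z else 0) (if b = 0 then y else flip s y) := by
  have h2 : (1 : ZMod 2) + 1 = 0 := rfl
  rcases zmod_two_cases b with rfl | rfl
  · by_cases h : y s = 0
    · have : Function.update y s 0 = y := by rw [← h, Function.update_eq_self]
      simp [prepKraus, h, this]
    · simp [prepKraus, h]
  · by_cases h : y s = 0
    · have : Function.update y s 1 = flip s y := by rw [← update_add_one, h, zero_add]
      simp [prepKraus, h, this]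
    · have h' := (zmod_two_cases (y s)).resolve_left h
      simp [prepKraus, h', h2]

/-- The same projection, followed by a multiple of `1 + X`. In the Fourier basis the latter
multiplies by `1 + sgn (x s)`, which kills the value 1. -/
theorem prepKraus_X (s : σ) (b : ZMod 2) (ψ : State σ) (y : σ → ZMod 2) :
    prepKraus .X s b ψ y = ((Real.sqrt 2 : ℝ) : ℂ)⁻¹ *
      ((fun z => if z s = b then ψ z else 0) y +
        (fun z => if z s = b then ψ z else 0) (flip s y)) := by
  have h2 : (1 : ZMod 2) + 1 = 0 := rfl
  simp only [prepKraus, flip_self]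
  by_cases h : y s = b
  · have : Function.update y s b = y := by rw [← h, Function.update_eq_self]
    simp [h, this]
  · have h' : y s + 1 = b := by
      revert h; generalize y s = a; revert a b; decide
    have : Function.update y s b = flip s y := by rw [← update_add_one, h']
    simp [h', h, this]

/-! ### Classical trajectories in one basis -/

/-- Values on the sites in one of the two bases, and the set of lost sites. -/
abbrev Conf (σ : Type) := (σ → ZMod 2) × Set σ

/-- The effect of a `CNOT` on the values in one of the two bases. -/
def cnotVal (B : Basis) (c t : σ) (x : σ → ZMod 2) : σ → ZMod 2 :=
  match B with
  | .Z => Function.update x t (x t + x c)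
  | .X => Function.update x c (x c + x t)

/-- The effect of one operation on the values in the basis `B`, with record `r`. -/
def Step {μ : Type} (B : Basis) (r : μ → ZMod 2) : Op σ μ → Conf σ → Conf σ → Prop
  | .prep B' s, p, p' =>
      (∀ u ≠ s, p'.1 u = p.1 u) ∧ (B' = B → p'.1 s = 0) ∧ p'.2 = p.2 \ {s}
  | .cnot c t, p, p' =>
      p'.1 = (if c ∈ p.2 ∨ t ∈ p.2 then p.1 else cnotVal B c t p.1) ∧ p'.2 = p.2
  | .swap s s', p, p' =>
      p'.1 = p.1 ∘ Equiv.swap s s' ∧ p'.2 = {v | Equiv.swap s s' v ∈ p.2}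
  | .meas B' s m, p, p' =>
      (∀ u ≠ s, p'.1 u = p.1 u) ∧ (B' = B → p'.1 s = p.1 s ∧ (s ∉ p.2 → r m = p.1 s)) ∧
        p'.2 = p.2

/-- Trajectories of a list of operations, the first of which is number `k`, in the basis `B`
under the loss configuration `l` and with record `r`. -/
def Run {μ : Type} (B : Basis) (l : Finset (ℕ × σ)) (r : μ → ZMod 2) :
    List (Op σ μ) → ℕ → Conf σ → Conf σ → Prop
  | [], _, p, p' => p = p'
  | o :: ops, k, p, p' =>
      ∃ p₁, Step B r o (p.1, p.2 ∪ {u | (k, u) ∈ l}) p₁ ∧ Run B l r ops (k + 1) p₁ p'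

theorem update_add_eq_add_single (t : σ) (a : ZMod 2) (x : σ → ZMod 2) :
    Function.update x t (x t + a) = x + Pi.single t a := by
  ext u
  by_cases h : u = t
  · subst h; simp
  · simp [h]

theorem update_add_involutive {c t : σ} (hct : c ≠ t) :
    Function.Involutive fun x : σ → ZMod 2 => Function.update x t (x t + x c) := by
  intro x
  ext u
  by_cases h : u = t
  · subst h; simp [hct, add_assoc, CharTwo.add_self_eq_zero]
  · simp [h]

end

/-! ### From quantum states to classical trajectories -/

section Fourier

variable {σ : Type} [Fintype σ]

/-- The amplitude of a state in the basis `Z` (computational) or `X` (Fourier transform). -/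
def amp (B : Basis) (ψ : State σ) (x : σ → ZMod 2) : ℂ :=
  match B with
  | .Z => ψ x
  | .X => ∑ y, sgn (x ⬝ᵥ y) * ψ y

theorem amp_add (B : Basis) (ψ φ : State σ) (x : σ → ZMod 2) :
    amp B (fun y => ψ y + φ y) x = amp B ψ x + amp B φ x := by
  cases B <;> simp [amp, mul_add, Finset.sum_add_distrib]

theorem amp_smul (B : Basis) (a : ℂ) (ψ : State σ) (x : σ → ZMod 2) :
    amp B (fun y => a * ψ y) x = a * amp B ψ x := by
  cases B
  · simp only [amp, Finset.mul_sum]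
    exact Finset.sum_congr rfl fun _ _ => by ring
  · rfl

theorem amp_X_flip (s : σ) (ψ : State σ) (x : σ → ZMod 2) :
    amp .X (fun y => ψ (flip s y)) x = sgn (x s) * amp .X ψ x := by
  simp only [amp, Finset.mul_sum]
  rw [← Equiv.sum_comp (Equiv.addRight (Pi.single s 1 : σ → ZMod 2))]
  refine Finset.sum_congr rfl fun y _ => ?_
  change sgn (x ⬝ᵥ flip s y) * ψ (flip s (flip s y)) = _
  rw [flip_flip, flip, dotProduct_add, dotProduct_single_one, sgn_add]
  ring

theorem amp_X_sgn (s : σ) (ψ : State σ) (x : σ → ZMod 2) :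
    amp .X (fun y => sgn (y s) * ψ y) x = amp .X ψ (flip s x) := by
  simp only [amp]
  refine Finset.sum_congr rfl fun y _ => ?_
  rw [flip, add_dotProduct, single_one_dotProduct, sgn_add]
  ring

theorem exists_amp_ne_zero (B : Basis) {ψ : State σ} (h : ψ ≠ 0) : ∃ x, amp B ψ x ≠ 0 := by
  cases B
  · by_contra! h0
    apply h
    ext z
    -- Fourier inversion: the transform of a nonzero state cannot vanish identically.
    have key : ∑ x, sgn (x ⬝ᵥ z) * amp .X ψ x = (Fintype.card (σ → ZMod 2) : ℂ) * ψ z := by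
      simp only [amp, Finset.mul_sum]
      rw [Finset.sum_comm, Finset.sum_eq_single z]
      · have (x : σ → ZMod 2) : sgn (x ⬝ᵥ z) * (sgn (x ⬝ᵥ z) * ψ z) = ψ z := by
          rw [← mul_assoc, ← sgn_add, CharTwo.add_self_eq_zero, sgn_zero, one_mul]
        simp [this]
      · intro y _ hy
        obtain ⟨s, hs⟩ : ∃ s, (z + y) s = 1 := by
          by_contra! hc
          apply hy
          ext s
          have := (zmod_two_cases ((z + y) s)).resolve_right (hc s)
          rw [Pi.add_apply, CharTwo.add_eq_zero] at this
          rw [this]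
        have h1 (x : σ → ZMod 2) :
            sgn (x ⬝ᵥ z) * (sgn (x ⬝ᵥ y) * ψ y) = sgn (x ⬝ᵥ (z + y)) * ψ y := by
          rw [dotProduct_add, sgn_add]; ring
        simp only [h1]
        -- Translation by the unit vector at `s`, where `z` and `y` differ, reverses the sign of
        -- every term, so the character sum is its own negative.
        have h2 := Equiv.sum_comp (Equiv.addRight (Pi.single s 1 : σ → ZMod 2))
          (fun x => sgn (x ⬝ᵥ (z + y)) * ψ y)
        have h3 (x : σ → ZMod 2) : sgn ((Equiv.addRight (Pi.single s 1 : σ → ZMod 2)) x ⬝ᵥ (z + y))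
            * ψ y = -(sgn (x ⬝ᵥ (z + y)) * ψ y) := by
          rw [Equiv.coe_addRight, add_dotProduct, single_one_dotProduct, hs, sgn_add, sgn_one]
          ring
        simp only [h3, Finset.sum_neg_distrib] at h2
        exact self_eq_neg.mp h2.symm
      · simp
    simp only [h0, mul_zero, Finset.sum_const_zero] at key
    simpa using key.symm
  · exact Function.ne_iff.mp h

theorem amp_X_proj (s : σ) (b : ZMod 2) (ψ : State σ) (x : σ → ZMod 2) :
    amp .X (fun y => if y s = b then ψ y else 0) x =
      (1 / 2 : ℂ) * (amp .X ψ x + sgn b * amp .X ψ (flip s x)) := by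
  simp only [proj_eq]
  rw [amp_smul, amp_add, amp_smul, amp_X_sgn]

theorem exists_of_amp_X_proj {s : σ} {b : ZMod 2} {ψ : State σ} {x : σ → ZMod 2}
    (h : amp .X (fun y => if y s = b then ψ y else 0) x ≠ 0) :
    ∃ y, amp .X ψ y ≠ 0 ∧ ∀ u ≠ s, x u = y u := by
  rw [amp_X_proj] at h
  by_cases h1 : amp .X ψ x = 0
  · refine ⟨flip s x, fun h2 => h (by simp [h1, h2]), fun u hu => (flip_of_ne hu x).symm⟩
  · exact ⟨x, h1, fun _ _ => rfl⟩

/-- One backward step of a trajectory. A preparation in the basis `B` pins the new value; one in the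
other basis only mixes the old values of that site. -/
theorem exists_of_amp_prepKraus {B B' : Basis} {s : σ} {b : ZMod 2} {ψ : State σ}
    {x : σ → ZMod 2} (h : amp B (prepKraus B' s b ψ) x ≠ 0) :
    ∃ y, amp B ψ y ≠ 0 ∧ (∀ u ≠ s, x u = y u) ∧ (B' = B → x s = 0) := by
  cases B' <;> cases B
  · have e : prepKraus .X s b ψ = _ := funext (prepKraus_X s b ψ)
    rw [e, amp_smul, amp_add, amp_X_flip s (fun z => if z s = b then ψ z else 0)] at h
    have h1 := right_ne_zero_of_mul h
    obtain ⟨y, hy, hu⟩ := exists_of_amp_X_proj (s := s) (b := b) (ψ := ψ) (x := x)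
      (fun h0 => h1 (by simp [h0]))
    refine ⟨y, hy, hu, fun _ => ?_⟩
    by_contra hs
    rw [(zmod_two_cases (x s)).resolve_left hs] at h1
    simp at h1
  · refine ⟨Function.update x s b, right_ne_zero_of_mul h, fun u hu => ?_, by simp⟩
    rw [Function.update_of_ne hu]
  · have e : prepKraus .Z s b ψ = _ := funext (prepKraus_Z s b ψ)
    rw [e] at h
    have h1 : amp .X (fun z => if z s = b then ψ z else 0) x ≠ 0 := by
      by_cases hb : b = 0
      · simpa only [hb, if_true] using h
      · simp only [if_neg hb] at h
        rw [amp_X_flip s (fun z => if z s = b then ψ z else 0)] at h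
        exact right_ne_zero_of_mul h
    obtain ⟨y, hy, hu⟩ := exists_of_amp_X_proj h1
    exact ⟨y, hy, hu, by simp⟩
  · simp only [amp, prepKraus] at h
    refine ⟨Function.update x s b, fun h0 => h (by simp [amp] at h0; simp [h0]), fun u hu => ?_,
      fun _ => ?_⟩
    · rw [Function.update_of_ne hu]
    · by_contra hs
      exact h (if_neg hs)

theorem exists_of_amp_measProj {B B' : Basis} {s : σ} {b : ZMod 2} {ψ : State σ}
    {x : σ → ZMod 2} (h : amp B (measProj B' s b ψ) x ≠ 0) :
    ∃ y, amp B ψ y ≠ 0 ∧ (∀ u ≠ s, x u = y u) ∧ (B' = B → x s = y s ∧ b = y s) := by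
  cases B'
  · have e : measProj .X s b ψ = fun x => (1 / 2 : ℂ) * (ψ x + sgn b * ψ (flip s x)) := by
      ext x; simp only [measProj, update_add_one, sgn]
    rw [e] at h
    cases B
    · rw [amp_smul, amp_add, amp_smul, amp_X_flip] at h
      refine ⟨x, fun h0 => h (by simp [h0]), fun _ _ => rfl, fun _ => ⟨rfl, ?_⟩⟩
      rcases zmod_two_cases b with rfl | rfl <;>
        rcases zmod_two_cases (x s) with hx | hx <;> simp_all
    · simp only [amp] at h
      by_cases h0 : ψ x = 0
      · exact ⟨flip s x, fun h1 => h (by simp only [amp] at h1; simp [h0, h1]),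
          fun u hu => (flip_of_ne hu x).symm, by simp⟩
      · exact ⟨x, h0, fun _ _ => rfl, by simp⟩
  · cases B
    · obtain ⟨y, hy, hu⟩ := exists_of_amp_X_proj h
      exact ⟨y, hy, hu, by simp⟩
    · simp only [amp, measProj] at h
      refine ⟨x, fun h0 => h (by simp only [amp] at h0; simp [h0]), fun _ _ => rfl,
        fun _ => ⟨rfl, ?_⟩⟩
      by_contra hs
      exact h (if_neg (Ne.symm hs))

/-- The Fourier transform turns a `CNOT` into its transpose, with control and target exchanged. The
condition `c ≠ t` makes both maps involutions. -/
theorem exists_of_amp_cnotGate {B : Basis} {c t : σ} (hct : c ≠ t) {ψ : State σ}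
    {x : σ → ZMod 2} (h : amp B (cnotGate c t ψ) x ≠ 0) :
    ∃ y, amp B ψ y ≠ 0 ∧ x = cnotVal B c t y := by
  cases B
  · refine ⟨Function.update x c (x c + x t), ?_, (update_add_involutive hct.symm x).symm⟩
    convert h using 1
    simp only [amp, cnotGate]
    rw [← Equiv.sum_comp (update_add_involutive hct).toPerm]
    refine Finset.sum_congr rfl fun y _ => ?_
    simp only [Function.Involutive.coe_toPerm]
    -- The two updates are inverse transposes of each other, so together they preserve the pairing.
    have e : Function.update x c (x c + x t) ⬝ᵥ Function.update y t (y t + y c) = x ⬝ᵥ y := by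
      rw [update_add_eq_add_single, update_add_eq_add_single, add_dotProduct, dotProduct_add,
        dotProduct_add, dotProduct_single, single_dotProduct, single_dotProduct,
        Pi.single_eq_of_ne hct]
      rw [mul_zero, add_zero, add_assoc, CharTwo.add_self_eq_zero, add_zero]
    rw [e]
  · exact ⟨_, h, (update_add_involutive hct x).symm⟩

theorem amp_swapGate (B : Basis) (s s' : σ) (ψ : State σ) (x : σ → ZMod 2) :
    amp B (swapGate s s' ψ) x = amp B ψ (x ∘ Equiv.swap s s') := by
  cases B
  · simp only [amp, swapGate]
    rw [← Equiv.sum_comp (Equiv.arrowCongr (Equiv.swap s s') (Equiv.refl (ZMod 2)))]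
    refine Finset.sum_congr rfl fun y _ => ?_
    have e : (Equiv.arrowCongr (Equiv.swap s s') (Equiv.refl (ZMod 2))) y =
        y ∘ Equiv.swap s s' := by ext u; simp [Equiv.arrowCongr]
    rw [e]
    congr 2
    · rw [dotProduct, dotProduct, ← Equiv.sum_comp (Equiv.swap s s')]
      simp
    · ext u; simp
  · rfl

/-- Every outcome of positive probability is the record of a trajectory in either basis. -/
theorem exists_run_of_canYield {μ : Type} (B : Basis) {l : Finset (ℕ × σ)} {r : μ → ZMod 2}
    (ops : List (Op σ μ)) (hops : ∀ c t, Op.cnot c t ∈ ops → c ≠ t) :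
    ∀ (k : ℕ) (ψ : State σ) (L : Set σ), CanYield l ops k ψ L r →
      ∃ x p', amp B ψ x ≠ 0 ∧ Run B l r ops k (x, L) p' := by
  induction ops with
  | nil =>
    intro k ψ L h
    obtain ⟨x, hx⟩ := exists_amp_ne_zero B (show ψ ≠ 0 from h)
    exact ⟨x, _, hx, rfl⟩
  | cons o ops ih =>
    intro k ψ L h
    replace ih := ih fun c t hc => hops c t (List.mem_cons_of_mem _ hc)
    cases o with
    | prep B' s =>
      obtain ⟨b, hb⟩ := h
      obtain ⟨x, p', hx, hr⟩ := ih _ _ _ hb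
      obtain ⟨y, hy, h1, h2⟩ := exists_of_amp_prepKraus hx
      exact ⟨y, p', hy, _, ⟨h1, h2, rfl⟩, hr⟩
    | cnot c t =>
      obtain ⟨x, p', hx, hr⟩ := ih _ _ _ h
      by_cases hl : c ∈ L ∪ {u | (k, u) ∈ l} ∨ t ∈ L ∪ {u | (k, u) ∈ l}
      · rw [if_pos hl] at hx
        exact ⟨x, p', hx, _, ⟨(if_pos hl).symm, rfl⟩, hr⟩
      · rw [if_neg hl] at hx
        obtain ⟨y, hy, h1⟩ := exists_of_amp_cnotGate (hops c t List.mem_cons_self) hx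
        exact ⟨y, p', hy, (x, _), ⟨h1.trans (if_neg hl).symm, rfl⟩, hr⟩
    | swap s s' =>
      obtain ⟨x, p', hx, hr⟩ := ih _ _ _ h
      rw [amp_swapGate] at hx
      refine ⟨_, p', hx, _, ⟨?_, rfl⟩, hr⟩
      ext u; simp
    | meas B' s m =>
      obtain ⟨x, p', hx, hr⟩ := ih _ _ _ h
      by_cases hl : s ∈ L ∪ {u | (k, u) ∈ l}
      · rw [if_pos hl] at hx
        exact ⟨x, p', hx, _, ⟨fun _ _ => rfl, fun _ => ⟨rfl, fun h0 => absurd hl h0⟩, rfl⟩, hr⟩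
      · rw [if_neg hl] at hx
        obtain ⟨y, hy, h1, h2⟩ := exists_of_amp_measProj hx
        exact ⟨y, p', hy, (x, _), ⟨h1, fun hB => ⟨(h2 hB).1, fun _ => (h2 hB).2⟩, rfl⟩, hr⟩

end Fourier

theorem run_append {σ μ : Type} {B : Basis} {l : Finset (ℕ × σ)} {r : μ → ZMod 2}
    (a b : List (Op σ μ)) : ∀ (k : ℕ) (p p' : Conf σ), Run B l r (a ++ b) k p p' →
      ∃ q, Run B l r a k p q ∧ Run B l r b (k + a.length) q p' := by
  induction a with
  | nil => intro k p p' h; exact ⟨p, rfl, h⟩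
  | cons o a ih =>
    rintro k p p' ⟨p₁, h1, h2⟩
    obtain ⟨q, hq, hq'⟩ := ih _ _ _ h2
    refine ⟨q, ⟨p₁, h1, hq⟩, ?_⟩
    rwa [List.length_cons, add_comm a.length, ← add_assoc]

namespace Code

variable {n nX nZ : ℕ} (C : Code n nX nZ)

/-! ### Spaces of errors caused by losses -/

/-- A single-qubit Pauli error or a hook error of the type opposite to the basis `B`. -/
def IsElementary (B : Basis) (w : Fin n → ZMod 2) : Prop :=
  (∃ q, w = Pi.single q 1) ∨ ∃ c t, checkType c ≠ B ∧ w = C.hook c t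

/-- The products of checks of the type opposite to the basis `B`. -/
def gauge (B : Basis) : Submodule (ZMod 2) (Fin n → ZMod 2) :=
  Submodule.span (ZMod 2) {w | ∃ c, checkType c ≠ B ∧ w = pauliVec (C.support c)}

/-- `V` is generated by checks and at most `m` elementary errors. -/
def IsErrorSpace (B : Basis) (m : ℕ) (V : Submodule (ZMod 2) (Fin n → ZMod 2)) : Prop :=
  ∃ W : Finset (Fin n → ZMod 2), W.card ≤ m ∧ (∀ w ∈ W, C.IsElementary B w) ∧
    V = Submodule.span (ZMod 2) (W : Set (Fin n → ZMod 2)) ⊔ C.gauge B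

variable {C} in
theorem IsErrorSpace.gauge_le {B : Basis} {m : ℕ} {V : Submodule (ZMod 2) (Fin n → ZMod 2)}
    (h : C.IsErrorSpace B m V) : C.gauge B ≤ V := by
  obtain ⟨W, -, -, rfl⟩ := h
  exact le_sup_right

/-- Number of losses before operation number `k`. -/
def lossCount {σ : Type} (l : Finset (ℕ × σ)) (k : ℕ) : ℕ := (l.filter fun a => a.1 < k).card

-- All losses just before operation `k` are charged together: `γ` names the error that a loss on
-- each site adds, and the bound on generators grows by their number.
variable {C} in
theorem IsErrorSpace.extend {B : Basis} {l : Finset (ℕ × Site n nX nZ)} {k : ℕ}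
    {V : Submodule (ZMod 2) (Fin n → ZMod 2)} (h : C.IsErrorSpace B (lossCount l k) V)
    (γ : Site n nX nZ → Fin n → ZMod 2) (hγ : ∀ s, C.IsElementary B (γ s)) :
    ∃ V', C.IsErrorSpace B (lossCount l (k + 1)) V' ∧ V ≤ V' ∧ ∀ s, (k, s) ∈ l → γ s ∈ V' := by
  obtain ⟨W, hc, hW, rfl⟩ := h
  refine ⟨_, ⟨W ∪ (l.filter fun a => a.1 = k).image fun a => γ a.2, ?_, ?_, rfl⟩, ?_, ?_⟩
  · refine (Finset.card_union_le _ _).trans ((add_le_add hc Finset.card_image_le).trans ?_)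
    rw [lossCount, lossCount, ← Finset.card_union_of_disjoint]
    · refine Finset.card_le_card fun a ha => ?_
      simp only [Finset.mem_union, Finset.mem_filter] at ha ⊢
      rcases ha with ⟨h1, h2⟩ | ⟨h1, h2⟩ <;> exact ⟨h1, by omega⟩
    · rw [Finset.disjoint_filter]
      intro a _ h1 h2
      omega
  · intro w hw
    rcases Finset.mem_union.mp hw with hw | hw
    · exact hW w hw
    · obtain ⟨a, -, rfl⟩ := Finset.mem_image.mp hw
      exact hγ _
  · refine sup_le_sup_right (Submodule.span_mono ?_) _
    rw [Finset.coe_union]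
    exact Set.subset_union_left
  · intro s hs
    refine Submodule.mem_sup_left (Submodule.subset_span ?_)
    simp only [Finset.coe_union, Set.mem_union, Finset.mem_coe, Finset.mem_image,
      Finset.mem_filter]
    exact Or.inr ⟨(k, s), ⟨hs, rfl⟩, rfl⟩

/-! ### Triples -/

/-- An assertion about an error space and a configuration. -/
abbrev Assertion (n nX nZ : ℕ) :=
  Submodule (ZMod 2) (Fin n → ZMod 2) → Conf (Site n nX nZ) → Prop

/-- If `P` holds before the operations, then `Q` holds after them, for an error space that is
enlarged by one elementary error for each loss. -/
def Triple (B : Basis) (r : Label n nX nZ → ZMod 2) (P : Assertion n nX nZ)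
    (ops : List (Op (Site n nX nZ) (Label n nX nZ))) (Q : Assertion n nX nZ) : Prop :=
  ∀ (l : Finset (ℕ × Site n nX nZ)) (k : ℕ) (V : Submodule (ZMod 2) (Fin n → ZMod 2))
    (p p' : Conf (Site n nX nZ)), C.IsErrorSpace B (lossCount l k) V → P V p →
    Run B l r ops k p p' →
    ∃ V', C.IsErrorSpace B (lossCount l (k + ops.length)) V' ∧ Q V' p'

section Triples

variable {C} {B : Basis} {r : Label n nX nZ → ZMod 2} {P Q S : Assertion n nX nZ}
  {a b : List (Op (Site n nX nZ) (Label n nX nZ))}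

theorem Triple.append (h : C.Triple B r P a Q) (h' : C.Triple B r Q b S) :
    C.Triple B r P (a ++ b) S := by
  intro l k V p p' hV hP hr
  obtain ⟨q, h1, h2⟩ := run_append _ _ _ _ _ hr
  obtain ⟨V₁, hV₁, hQ⟩ := h l k V p q hV hP h1
  obtain ⟨V₂, hV₂, hS⟩ := h' l _ V₁ q p' hV₁ hQ h2
  refine ⟨V₂, ?_, hS⟩
  rwa [List.length_append, ← add_assoc]

theorem Triple.nil (h : ∀ V p, C.gauge B ≤ V → P V p → Q V p) : C.Triple B r P [] Q := by
  rintro l k V p p' hV hP rfl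
  exact ⟨V, hV, h V p hV.gauge_le hP⟩

/-- One operation: the losses just before it, then its effect. -/
theorem Triple.single {o : Op (Site n nX nZ) (Label n nX nZ)} (γ : Site n nX nZ → Fin n → ZMod 2)
    (hγ : ∀ s, C.IsElementary B (γ s))
    (h1 : ∀ V V' x L N, V ≤ V' → C.gauge B ≤ V' → (∀ s ∈ N, γ s ∈ V') → P V (x, L) →
      P V' (x, L ∪ N))
    (h2 : ∀ V p p', C.gauge B ≤ V → P V p → Step B r o p p' → Q V p') :
    C.Triple B r P [o] Q := by
  rintro l k V ⟨x, L⟩ p' hV hP ⟨p₁, hs, rfl⟩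
  obtain ⟨V', hV', hle, hN⟩ := hV.extend γ hγ
  exact ⟨V', hV', h2 V' _ _ hV'.gauge_le
    (h1 V V' x L {u | (k, u) ∈ l} hle hV'.gauge_le hN hP) hs⟩

theorem Triple.flatMap {α : Type} {f : α → List (Op (Site n nX nZ) (Label n nX nZ))}
    {I : List α → Assertion n nX nZ} (h : ∀ i is, C.Triple B r (I (i :: is)) (f i) (I is)) :
    ∀ is, C.Triple B r (I is) (is.flatMap f) (I []) := by
  intro is
  induction is with
  | nil => exact Triple.nil fun _ _ _ h => h
  | cons i is ih => rw [List.flatMap_cons]; exact (h i is).append ih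

theorem Triple.map {α : Type} {f : α → Op (Site n nX nZ) (Label n nX nZ)}
    {I : List α → Assertion n nX nZ} (h : ∀ i is, C.Triple B r (I (i :: is)) [f i] (I is)) :
    ∀ is, C.Triple B r (I is) (is.map f) (I []) := by
  intro is
  induction is with
  | nil => exact Triple.nil fun _ _ _ h => h
  | cons i is ih => exact (h i is).append ih

theorem Triple.weaken (h : C.Triple B r P a Q) {P' Q' : Assertion n nX nZ}
    (hP : ∀ V p, C.gauge B ≤ V → P' V p → P V p) (hQ : ∀ V p, C.gauge B ≤ V → Q V p → Q' V p) :
    C.Triple B r P' a Q' := by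
  simpa using ((Triple.nil hP).append h).append (Triple.nil hQ)

end Triples

/-! ### Invariants of the circuit -/

/-- The values on the data sites. -/
def data (x : Site n nX nZ → ZMod 2) : Fin n → ZMod 2 := fun q => x (.inl q)

/-- All data errors lie in the error space, and so do all errors on lost data qubits. -/
def DataInv : Assertion n nX nZ := fun V p =>
  data p.1 ∈ V ∧ ∀ q, .inl q ∈ p.2 → Pi.single q 1 ∈ V

/-- The ancilla of the check `c` is ready for use. -/
def Ready (B : Basis) (c : Fin nX ⊕ Fin nZ) : Assertion n nX nZ := fun V p =>
  (.inr c ∈ p.2 → Pi.single (C.first c) 1 ∈ V) ∧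
    (checkType c = B → .inr c ∉ p.2 → p.1 (.inr c) = 0)

/-- The elementary error assigned to a loss outside the gates of a check. -/
def lossError : Site n nX nZ → Fin n → ZMod 2
  | .inl q => Pi.single q 1
  | .inr c => Pi.single (C.first c) 1

theorem isElementary_lossError (B : Basis) (s : Site n nX nZ) :
    C.IsElementary B (C.lossError s) := by
  cases s <;> exact Or.inl ⟨_, rfl⟩

variable {C} {B : Basis} {r : Label n nX nZ → ZMod 2}

theorem DataInv.loss {V V' : Submodule (ZMod 2) (Fin n → ZMod 2)} {x : Site n nX nZ → ZMod 2}
    {L N : Set (Site n nX nZ)} (h : DataInv V (x, L)) (hle : V ≤ V')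
    (hN : ∀ q, .inl q ∈ N → Pi.single q 1 ∈ V') : DataInv V' (x, L ∪ N) :=
  ⟨hle h.1, fun q hq => hq.elim (fun h0 => hle (h.2 q h0)) (hN q)⟩

theorem Ready.loss {c : Fin nX ⊕ Fin nZ} {V V' : Submodule (ZMod 2) (Fin n → ZMod 2)}
    {x : Site n nX nZ → ZMod 2} {L N : Set (Site n nX nZ)} (h : C.Ready B c V (x, L))
    (hle : V ≤ V') (hN : .inr c ∈ N → Pi.single (C.first c) 1 ∈ V') :
    C.Ready B c V' (x, L ∪ N) :=
  ⟨fun hq => hq.elim (fun h0 => hle (h.1 h0)) hN, fun hB hq => h.2 hB fun h0 => hq (Or.inl h0)⟩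

/-! ### Preparations and measurements -/

/-- A preparation undoes earlier losses on its site, so the invariant is claimed only for qubits
outside the list of those still to be prepared. -/
theorem triple_prep_data : C.Triple B r (fun _ _ => True)
    ((List.finRange n).map fun q => Op.prep B (.inl q)) DataInv := by
  refine (Triple.map (I := fun qs V p => ∀ q, q ∉ qs →
    p.1 (.inl q) = 0 ∧ (.inl q ∈ p.2 → Pi.single q 1 ∈ V)) ?_ _).weaken ?_ ?_
  · intro i is
    refine Triple.single C.lossError (C.isElementary_lossError B) ?_ ?_
    · intro V V' x L N hle _ hN h q hq
      exact ⟨(h q hq).1, fun h0 => h0.elim (fun h0 => hle ((h q hq).2 h0)) (hN (.inl q))⟩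
    · rintro V p p' - h ⟨h1, h2, h3⟩ q hq
      rw [h3]
      by_cases hi : q = i
      · subst hi
        exact ⟨h2 rfl, fun h0 => absurd rfl h0.2⟩
      · have := h q (by simp [hi, hq])
        exact ⟨(h1 _ (by simpa using hi)).trans this.1, fun h0 => this.2 h0.1⟩
  · intro V p _ _ q hq
    simp at hq
  · intro V p _ h
    refine ⟨?_, fun q => (h q (by simp)).2⟩
    have : data p.1 = 0 := funext fun q => (h q (by simp)).1
    rw [this]
    exact V.zero_mem

theorem triple_prep_ancillas : C.Triple B r DataInv
    ((allChecks nX nZ).map fun c => Op.prep (checkType c) (.inr c))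
    (fun V p => DataInv V p ∧ ∀ c, C.Ready B c V p) := by
  refine (Triple.map (I := fun cs V p => DataInv V p ∧ ∀ c, c ∉ cs → C.Ready B c V p) ?_ _).weaken
    ?_ ?_
  · intro i is
    refine Triple.single C.lossError (C.isElementary_lossError B) ?_ ?_
    · rintro V V' x L N hle - hN ⟨h, h'⟩
      exact ⟨h.loss hle fun q => hN (.inl q), fun c hc => (h' c hc).loss hle (hN (.inr c))⟩
    · rintro V p p' - ⟨h, h'⟩ ⟨h1, h2, h3⟩
      refine ⟨⟨?_, ?_⟩, ?_⟩
      · have : data p'.1 = data p.1 := funext fun q => h1 _ (by simp)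
        rw [this]
        exact h.1
      · intro q hq
        rw [h3] at hq
        exact h.2 q hq.1
      · intro c hc
        rw [Ready, h3]
        by_cases hi : c = i
        · subst hi
          exact ⟨fun h0 => absurd rfl h0.2, fun hB _ => h2 hB⟩
        · have := h' c (by simp [hi, hc])
          have hne : (Sum.inr c : Site n nX nZ) ≠ .inr i := by simpa using hi
          exact ⟨fun h0 => this.1 h0.1, fun hB h0 => (h1 _ hne).trans
            (this.2 hB fun h4 => h0 ⟨h4, hne⟩)⟩
  · intro V p _ h
    refine ⟨h, fun c hc => absurd ?_ hc⟩
    cases c <;> simp [allChecks]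
  · exact fun V p _ h => ⟨h.1, fun c => h.2 c (by simp)⟩

/-- The invariant concerns the data alone, so the ancilla results may be anything. -/
theorem triple_meas_ancillas (k : ℕ) : C.Triple B r DataInv
    ((allChecks nX nZ).map fun c => Op.meas (checkType c) (.inr c) (.inl (k, c))) DataInv := by
  refine Triple.map (I := fun _ => DataInv) ?_ _
  intro i is
  refine Triple.single C.lossError (C.isElementary_lossError B) ?_ ?_
  · rintro V V' x L N hle - hN h
    exact h.loss hle fun q => hN (.inl q)
  · rintro V p p' - h ⟨h1, h2, h3⟩
    have : data p'.1 = data p.1 := funext fun q => h1 _ (by simp)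
    rw [DataInv, this, h3]
    exact h

/-- A vector is in a submodule if another one is, and they differ only at coordinates whose unit
vectors are in the submodule. -/
theorem mem_of_eq_or_single_mem {V : Submodule (ZMod 2) (Fin n → ZMod 2)} {v w : Fin n → ZMod 2}
    (hv : v ∈ V) (h : ∀ q, w q = v q ∨ Pi.single q 1 ∈ V) : w ∈ V := by
  have : w = v + ∑ q, (w q - v q) • Pi.single q (1 : ZMod 2) := by
    ext u
    simp [Finset.sum_apply, Pi.single_apply]
  rw [this]
  refine V.add_mem hv (V.sum_mem fun q _ => ?_)
  rcases h q with h | h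
  · simp [h]
  · exact V.smul_mem _ h

/-- A lost data qubit reports an arbitrary bit, but its unit vector is already in `V`. The record
therefore differs from the data values by an element of `V`. -/
theorem triple_meas_data : C.Triple B r DataInv
    ((List.finRange n).map fun q => Op.meas B (.inl q) (.inr q))
    (fun V _ => (fun q => r (.inr q)) ∈ V) := by
  refine (Triple.map (I := fun qs V p => DataInv V p ∧ ∀ q, q ∉ qs →
    r (.inr q) = p.1 (.inl q) ∨ Pi.single q 1 ∈ V) ?_ _).weaken ?_ ?_
  · intro i is
    refine Triple.single C.lossError (C.isElementary_lossError B) ?_ ?_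
    · rintro V V' x L N hle - hN ⟨h, h'⟩
      exact ⟨h.loss hle fun q => hN (.inl q), fun q hq => (h' q hq).imp_right fun h0 => hle h0⟩
    · rintro V p p' - ⟨h, h'⟩ ⟨h1, h2, h3⟩
      have he : p'.1 = p.1 := by
        ext u
        by_cases hu : u = .inl i
        · subst hu; exact (h2 rfl).1
        · exact h1 u hu
      rw [DataInv, he, h3]
      refine ⟨h, fun q hq => ?_⟩
      by_cases hi : q = i
      · subst hi
        by_cases hl : .inl q ∈ p.2
        · exact Or.inr (h.2 q hl)
        · exact Or.inl ((h2 rfl).2 hl)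
      · exact h' q (by simp [hi, hq])
  · exact fun V p _ h => ⟨h, fun q hq => absurd (List.mem_finRange q) hq⟩
  · exact fun V p _ h => mem_of_eq_or_single_mem h.1.1 fun q => h.2 q (by simp)

end Code

namespace Code

variable {n nX nZ : ℕ} {C : Code n nX nZ} {B : Basis} {r : Label n nX nZ → ZMod 2}

/-! ### The gates of one check -/

theorem Ready.of_eq {c : Fin nX ⊕ Fin nZ} {V : Submodule (ZMod 2) (Fin n → ZMod 2)}
    {p p' : Conf (Site n nX nZ)} (h : C.Ready B c V p) (hv : p'.1 (.inr c) = p.1 (.inr c))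
    (hl : .inr c ∈ p'.2 ↔ .inr c ∈ p.2) : C.Ready B c V p' :=
  ⟨fun h0 => h.1 (hl.mp h0), fun hB h0 => hv.trans (h.2 hB fun h1 => h0 (hl.mpr h1))⟩

/-- In the basis `B` the gate writes on the ancilla if the check has type `B`, and on the data
otherwise. This treats both types and both bases uniformly from here on. -/
theorem step_checkCnot {c : Fin nX ⊕ Fin nZ} {q : Fin n} {p p' : Conf (Site n nX nZ)}
    (h : Step B r (Code.checkCnot c q) p p') :
    p'.2 = p.2 ∧ ((.inr c ∈ p.2 ∨ .inl q ∈ p.2) ∧ p'.1 = p.1 ∨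
      (.inr c ∉ p.2 ∧ .inl q ∉ p.2) ∧
        (checkType c = B → p'.1 (.inr c) = p.1 (.inr c) + p.1 (.inl q) ∧ data p'.1 = data p.1 ∧
          ∀ c' ≠ c, p'.1 (.inr c') = p.1 (.inr c')) ∧
        (checkType c ≠ B → data p'.1 = data p.1 + p.1 (.inr c) • Pi.single q 1 ∧
          ∀ c', p'.1 (.inr c') = p.1 (.inr c'))) := by
  unfold Code.checkCnot at h
  rcases hc : checkType c with _ | _ <;> rw [hc] at h <;> obtain ⟨h1, h2⟩ := h <;>
    refine ⟨h2, ?_⟩ <;> split_ifs at h1 with hl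
  · exact Or.inl ⟨hl, h1⟩
  · refine Or.inr ⟨not_or.mp hl, ?_⟩
    cases B
    · refine ⟨fun _ => ⟨?_, funext fun u => ?_, fun c' hc' => ?_⟩, fun h => absurd rfl h⟩ <;>
        simp_all [cnotVal, data]
    · refine ⟨fun h => (nomatch h), fun _ => ⟨funext fun u => ?_, fun c' => ?_⟩⟩
      · by_cases hu : u = q <;> simp_all [cnotVal, data]
      · simp_all [cnotVal]
  · exact Or.inl ⟨hl.symm, h1⟩
  · refine Or.inr ⟨(not_or.mp hl).symm, ?_⟩
    cases B
    · refine ⟨fun h => (nomatch h), fun _ => ⟨funext fun u => ?_, fun c' => ?_⟩⟩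
      · by_cases hu : u = q <;> simp_all [cnotVal, data]
      · simp_all [cnotVal]
    · refine ⟨fun _ => ⟨?_, funext fun u => ?_, fun c' hc' => ?_⟩, fun h => absurd rfl h⟩ <;>
        simp_all [cnotVal, data]

theorem step_swap {σ μ : Type} {r : μ → ZMod 2} {s s' : σ} {p p' : Conf σ}
    (h : Step B r (.swap s s') p p') :
    p'.1 s = p.1 s' ∧ p'.1 s' = p.1 s ∧ (s ∈ p'.2 ↔ s' ∈ p.2) ∧ (s' ∈ p'.2 ↔ s ∈ p.2) ∧
      ∀ u, u ≠ s → u ≠ s' → p'.1 u = p.1 u ∧ (u ∈ p'.2 ↔ u ∈ p.2) := by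
  obtain ⟨h1, h2⟩ := h
  rw [h1, h2]
  refine ⟨by simp, by simp, by simp, by simp, fun u hu hu' => ?_⟩
  simp [Equiv.swap_apply_of_ne_of_ne hu hu']

/-- Modulo 2, exchanging two values adds their sum to both. The swap thus changes the data by a
multiple of one unit vector. -/
theorem data_step_swap {c : Fin nX ⊕ Fin nZ} {q : Fin n} {p p' : Conf (Site n nX nZ)}
    (h : Step B r (.swap (.inr c) (.inl q)) p p') :
    data p'.1 = data p.1 + (p.1 (.inr c) + p.1 (.inl q)) • Pi.single q 1 := by
  obtain ⟨-, h2, -, -, h3⟩ := step_swap h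
  ext u
  by_cases hu : u = q
  · subst hu
    simp only [data, Pi.add_apply, Pi.smul_apply, Pi.single_eq_same, smul_eq_mul, mul_one, h2]
    rw [add_comm, add_assoc, CharTwo.add_self_eq_zero, add_zero]
  · simp [data, hu, h3 (.inl u) (by simp) (by simpa using hu)]

/-- Errors on lost data qubits lie in the error space, and the ancillas of the checks `cs` are
ready for use. -/
def Background (C : Code n nX nZ) (B : Basis) (cs : List (Fin nX ⊕ Fin nZ)) : Assertion n nX nZ :=
  fun V p => (∀ q, .inl q ∈ p.2 → Pi.single q 1 ∈ V) ∧ ∀ c ∈ cs, C.Ready B c V p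

theorem Background.loss {cs : List (Fin nX ⊕ Fin nZ)}
    {V V' : Submodule (ZMod 2) (Fin n → ZMod 2)} {x : Site n nX nZ → ZMod 2}
    {L N : Set (Site n nX nZ)} (h : Background C B cs V (x, L)) (hle : V ≤ V')
    (hq : ∀ q, .inl q ∈ N → Pi.single q 1 ∈ V')
    (hc : ∀ c ∈ cs, .inr c ∈ N → Pi.single (C.first c) 1 ∈ V') :
    Background C B cs V' (x, L ∪ N) :=
  ⟨fun q h0 => h0.elim (fun h0 => hle (h.1 q h0)) (hq q),
    fun c h0 => (h.2 c h0).loss hle (hc c h0)⟩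

theorem Background.of_checkCnot {c : Fin nX ⊕ Fin nZ} {cs : List (Fin nX ⊕ Fin nZ)} (hc : c ∉ cs)
    {V : Submodule (ZMod 2) (Fin n → ZMod 2)} {q : Fin n} {p p' : Conf (Site n nX nZ)}
    (h : Background C B cs V p) (hs : Step B r (Code.checkCnot c q) p p') :
    Background C B cs V p' := by
  obtain ⟨h1, h2⟩ := step_checkCnot hs
  refine ⟨by rw [h1]; exact h.1, fun c' hc' => (h.2 c' hc').of_eq ?_ (by rw [h1])⟩
  have hne : c' ≠ c := fun h0 => hc (h0 ▸ hc')
  rcases h2 with ⟨-, h2⟩ | ⟨-, h2, h3⟩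
  · rw [h2]
  · by_cases hB : checkType c = B
    · exact (h2 hB).2.2 c' hne
    · exact (h3 hB).2 c'

theorem Background.of_swap {c : Fin nX ⊕ Fin nZ} {cs : List (Fin nX ⊕ Fin nZ)} (hc : c ∉ cs)
    {V : Submodule (ZMod 2) (Fin n → ZMod 2)} {q : Fin n} {p p' : Conf (Site n nX nZ)}
    (h : Background C B cs V p) (hl : .inr c ∈ p.2 → Pi.single q 1 ∈ V)
    (hs : Step B r (.swap (.inr c) (.inl q)) p p') : Background C B cs V p' := by
  obtain ⟨-, -, -, h2, h3⟩ := step_swap hs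
  refine ⟨fun u hu => ?_, fun c' hc' => ?_⟩
  · by_cases h0 : u = q
    · subst h0
      exact hl (h2.mp hu)
    · exact h.1 u ((h3 (.inl u) (by simp) (by simpa using h0)).2.mp hu)
  · have hne : c' ≠ c := fun h0 => hc (h0 ▸ hc')
    obtain ⟨h4, h5⟩ := h3 (.inr c') (by simpa using hne) (by simp)
    exact (h.2 c' hc').of_eq h4 h5

/-- The gates of a check of type `B`: its ancilla collects a parity and does not act on the data. -/
theorem triple_checkBlock_same {c : Fin nX ⊕ Fin nZ} {cs : List (Fin nX ⊕ Fin nZ)} (hc : c ∉ cs)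
    (hB : checkType c = B) :
    C.Triple B r (fun V p => DataInv V p ∧ ∀ c' ∈ c :: cs, C.Ready B c' V p) (C.checkBlock c)
      (fun V p => DataInv V p ∧ ∀ c' ∈ cs, C.Ready B c' V p) := by
  -- Between the first `CNOT` and the swap, either the ancilla has copied the value of the first
  -- qubit, so that the swap changes no data value, or the unit vector of that qubit is already in
  -- `V`.
  refine Triple.append (a := [_]) (Q := fun V p => Background C B cs V p ∧ data p.1 ∈ V ∧
      (.inr c ∈ p.2 → Pi.single (C.first c) 1 ∈ V) ∧
      (Pi.single (C.first c) 1 ∈ V ∨ p.1 (.inr c) = p.1 (.inl (C.first c)))) ?_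
    (Triple.append (a := [_]) (Q := fun V p => DataInv V p ∧ ∀ c' ∈ cs, C.Ready B c' V p) ?_ ?_)
  · refine Triple.single C.lossError (C.isElementary_lossError B) ?_ ?_
    · rintro V V' x L N hle - hN ⟨h, h'⟩
      exact ⟨h.loss hle fun q => hN (.inl q),
        fun c' hc' => (h' c' hc').loss hle (hN (.inr c'))⟩
    · rintro V p p' - ⟨h, h'⟩ hs
      have hb : Background C B cs V p := ⟨h.2, fun c' hc' => h' c' (by simp [hc'])⟩
      refine ⟨hb.of_checkCnot hc hs, ?_⟩
      obtain ⟨h1, h2⟩ := step_checkCnot hs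
      obtain ⟨hr1, hr2⟩ := h' c (by simp)
      rw [h1]
      rcases h2 with ⟨h2, h3⟩ | ⟨h2, h3, -⟩
      · rw [h3]
        exact ⟨h.1, hr1, Or.inl (h2.elim hr1 (h.2 _))⟩
      · obtain ⟨h4, h5, -⟩ := h3 hB
        rw [h5]
        refine ⟨h.1, hr1, Or.inr ?_⟩
        rw [h4, hr2 hB h2.1, zero_add]
        exact (congrFun h5 (C.first c)).symm
  · refine Triple.single C.lossError (C.isElementary_lossError B) ?_ ?_
    · rintro V V' x L N hle - hN ⟨h, h1, h2, h3⟩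
      exact ⟨h.loss hle (fun q => hN (.inl q)) (fun c' _ => hN (.inr c')), hle h1,
        fun h0 => h0.elim (fun h0 => hle (h2 h0)) (hN (.inr c)), h3.imp_left fun h0 => hle h0⟩
    · rintro V p p' - ⟨h, h1, h2, h3⟩ hs
      have hb := h.of_swap hc h2 hs
      refine ⟨⟨?_, hb.1⟩, hb.2⟩
      rw [data_step_swap hs]
      refine V.add_mem h1 ?_
      rcases h3 with h3 | h3
      · exact V.smul_mem _ h3
      · rw [h3, CharTwo.add_self_eq_zero, zero_smul]
        exact V.zero_mem
  · refine Triple.map (I := fun _ V p => DataInv V p ∧ ∀ c' ∈ cs, C.Ready B c' V p) ?_ _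
    intro i is
    refine Triple.single C.lossError (C.isElementary_lossError B) ?_ ?_
    · rintro V V' x L N hle - hN ⟨h, h'⟩
      exact ⟨h.loss hle fun q => hN (.inl q),
        fun c' hc' => (h' c' hc').loss hle (hN (.inr c'))⟩
    · rintro V p p' - ⟨h, h'⟩ hs
      have hb : Background C B cs V p := ⟨h.2, h'⟩
      have hb' := hb.of_checkCnot hc hs
      refine ⟨⟨?_, hb'.1⟩, hb'.2⟩
      obtain ⟨h1, h2⟩ := step_checkCnot hs
      rcases h2 with ⟨-, h3⟩ | ⟨-, h3, -⟩
      · rw [h3]; exact h.1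
      · rw [(h3 hB).2.1]; exact h.1

/-- After the swap and the gates of the check `c` with its first `t` qubits: if the ancilla is not
lost, its value controls the hook error. -/
def Hooked (C : Code n nX nZ) (c : Fin nX ⊕ Fin nZ) (t : ℕ) : Assertion n nX nZ := fun V p =>
  (.inr c ∈ p.2 → data p.1 ∈ V) ∧
    (.inr c ∉ p.2 → data p.1 + p.1 (.inr c) • C.hook c t ∈ V)

theorem hook_one (c : Fin nX ⊕ Fin nZ) : C.hook c 1 = Pi.single (C.first c) 1 := by
  simp [hook, support, pauliVec]

theorem smul_add_smul_self_eq_zero (a : ZMod 2) (v : Fin n → ZMod 2) : a • v + a • v = 0 := by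
  ext u
  exact CharTwo.add_self_eq_zero (R := ZMod 2) _

/-- The first gate and the swap of a check of the type opposite to `B`. -/
theorem triple_first_swap {c : Fin nX ⊕ Fin nZ} {cs : List (Fin nX ⊕ Fin nZ)} (hc : c ∉ cs)
    (hB : checkType c ≠ B) :
    C.Triple B r (fun V p => DataInv V p ∧ ∀ c' ∈ c :: cs, C.Ready B c' V p)
      ([Code.checkCnot c (C.first c)] ++ [.swap (.inr c) (.inl (C.first c))])
      (fun V p => Background C B cs V p ∧ Hooked C c 1 V p) := by
  -- Already before the swap the ancilla value controls `H_{c,1}`. The swap adds the same multiple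
  -- to the data as to the ancilla value, so this relation survives it.
  refine Triple.append (Q := fun V p => Background C B cs V p ∧
      (.inr c ∈ p.2 → Pi.single (C.first c) 1 ∈ V) ∧
      data p.1 + p.1 (.inr c) • Pi.single (C.first c) 1 ∈ V) ?_ ?_
  · refine Triple.single C.lossError (C.isElementary_lossError B) ?_ ?_
    · rintro V V' x L N hle - hN ⟨h, h'⟩
      exact ⟨h.loss hle fun q => hN (.inl q),
        fun c' hc' => (h' c' hc').loss hle (hN (.inr c'))⟩
    · rintro V p p' - ⟨h, h'⟩ hs
      have hb : Background C B cs V p := ⟨h.2, fun c' hc' => h' c' (by simp [hc'])⟩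
      refine ⟨hb.of_checkCnot hc hs, ?_⟩
      obtain ⟨h1, h2⟩ := step_checkCnot hs
      obtain ⟨hr1, -⟩ := h' c (by simp)
      rw [h1]
      refine ⟨hr1, ?_⟩
      rcases h2 with ⟨h2, h3⟩ | ⟨h2, -, h3⟩
      · rw [h3]
        exact V.add_mem h.1 (V.smul_mem _ (h2.elim hr1 (h.2 _)))
      · rw [(h3 hB).1, (h3 hB).2, add_assoc, smul_add_smul_self_eq_zero, add_zero]
        exact h.1
  · refine Triple.single C.lossError (C.isElementary_lossError B) ?_ ?_
    · rintro V V' x L N hle - hN ⟨h, h1, h2⟩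
      exact ⟨h.loss hle (fun q => hN (.inl q)) (fun c' _ => hN (.inr c')),
        fun h0 => h0.elim (fun h0 => hle (h1 h0)) (hN (.inr c)), hle h2⟩
    · rintro V p p' - ⟨h, h1, h2⟩ hs
      refine ⟨h.of_swap hc h1 hs, ?_⟩
      obtain ⟨h3, -, h4, -⟩ := step_swap hs
      rw [Hooked, h3, h4, data_step_swap hs, hook_one, add_smul, ← add_assoc]
      refine ⟨fun h0 => V.add_mem h2 (V.smul_mem _ (h.1 _ h0)), fun _ => ?_⟩
      rw [add_assoc, smul_add_smul_self_eq_zero, add_zero]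
      exact h2

theorem hook_succ {c : Fin nX ⊕ Fin nZ} {pre is : List (Fin n)} {i : Fin n}
    (h : pre ++ i :: is = C.support c) :
    C.hook c (pre.length + 1) = C.hook c pre.length + Pi.single i 1 := by
  have h1 : (C.support c).take (pre.length + 1) = pre ++ [i] := by
    rw [← h, List.take_length_add_append]; rfl
  have h2 : (C.support c).take pre.length = pre := by rw [← h, List.take_left']; rfl
  simp [hook, h1, h2, pauliVec]

/-- One further gate of a check of the type opposite to `B`. -/
theorem triple_hooked_succ {c : Fin nX ⊕ Fin nZ} {cs : List (Fin nX ⊕ Fin nZ)} (hc : c ∉ cs)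
    (hB : checkType c ≠ B) {pre is : List (Fin n)} {i : Fin n}
    (hp : pre ++ i :: is = C.support c) :
    C.Triple B r (fun V p => Background C B cs V p ∧ Hooked C c pre.length V p)
      [Code.checkCnot c i]
      (fun V p => Background C B cs V p ∧ Hooked C c (pre.length + 1) V p) := by
  -- A loss of the active ancilla at this moment is charged as the hook error accumulated so far;
  -- all other sites keep their default error.
  refine Triple.single (Function.update C.lossError (.inr c) (C.hook c pre.length)) ?_ ?_ ?_
  · intro s
    by_cases hs : s = .inr c
    · subst hs
      rw [Function.update_self]
      exact Or.inr ⟨c, _, hB, rfl⟩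
    · rw [Function.update_of_ne hs]
      exact C.isElementary_lossError B s
  · rintro V V' x L N hle - hN ⟨h, h1, h2⟩
    refine ⟨h.loss hle (fun q hq => ?_) (fun c' hc' hq => ?_), ?_, fun h0 =>
      hle (h2 fun h3 => h0 (Or.inl h3))⟩
    · simpa [lossError] using hN _ hq
    · have hne : c' ≠ c := fun h0 => hc (h0 ▸ hc')
      simpa [lossError, hne] using hN _ hq
    · intro h0
      by_cases h3 : .inr c ∈ L
      · exact hle (h1 h3)
      · have h4 := hN _ (h0.resolve_left h3)
        rw [Function.update_self] at h4
        exact (V'.add_mem_iff_left (V'.smul_mem _ h4)).mp (hle (h2 h3))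
  · rintro V p p' - ⟨h, h1, h2⟩ hs
    refine ⟨h.of_checkCnot hc hs, ?_⟩
    obtain ⟨h3, h4⟩ := step_checkCnot hs
    rw [Hooked, h3, hook_succ hp, smul_add, ← add_assoc]
    rcases h4 with ⟨h4, h5⟩ | ⟨h4, -, h5⟩
    · rw [h5]
      -- A gate skipped because of a lost data qubit leaves the hook without its new factor, which
      -- is in `V` for that very reason.
      exact ⟨h1, fun h0 => V.add_mem (h2 h0) (V.smul_mem _ (h.1 _ (h4.resolve_left h0)))⟩
    · refine ⟨fun h0 => absurd h0 h4.1, fun h0 => ?_⟩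
      rw [(h5 hB).1, (h5 hB).2, add_right_comm (data p.1),
        add_assoc _ (_ • Pi.single i 1), smul_add_smul_self_eq_zero, add_zero]
      exact h2 h0

/-- The gates of a check of the type opposite to `B`: its ancilla controls a product of checks. -/
theorem triple_checkBlock_opposite {c : Fin nX ⊕ Fin nZ} {cs : List (Fin nX ⊕ Fin nZ)}
    (hc : c ∉ cs) (hB : checkType c ≠ B) :
    C.Triple B r (fun V p => DataInv V p ∧ ∀ c' ∈ c :: cs, C.Ready B c' V p) (C.checkBlock c)
      (fun V p => DataInv V p ∧ ∀ c' ∈ cs, C.Ready B c' V p) := by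
  refine (triple_first_swap hc hB).append (b := (C.rest c).map (Code.checkCnot c)) ?_
  refine (Triple.map (I := fun qs V p => ∃ pre, pre ++ qs = C.support c ∧
    Background C B cs V p ∧ Hooked C c pre.length V p) ?_ (C.rest c)).weaken ?_ ?_
  · rintro i is l k V p p' hV ⟨pre, hp, h⟩ hr
    obtain ⟨V', hV', h'⟩ := triple_hooked_succ hc hB hp l k V p p' hV h hr
    refine ⟨V', hV', pre ++ [i], by simpa using hp, ?_⟩
    simpa using h'
  · exact fun V p _ h => ⟨[C.first c], rfl, h⟩
  · rintro V p hg ⟨pre, hp, h, h1, h2⟩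
    refine ⟨⟨?_, h.1⟩, h.2⟩
    by_cases h0 : .inr c ∈ p.2
    · exact h1 h0
    · refine (V.add_mem_iff_left (V.smul_mem _ (hg (Submodule.subset_span ⟨c, hB, ?_⟩)))).mp
        (h2 h0)
      rw [List.append_nil] at hp
      rw [hook, hp, List.take_length]

/-! ### The memory experiment -/

theorem nodup_allChecks : (allChecks nX nZ).Nodup := by
  refine List.Nodup.append ((List.nodup_finRange _).map Sum.inl_injective)
    ((List.nodup_finRange _).map Sum.inr_injective) ?_
  simp [List.disjoint_left]

theorem triple_cycle (k : ℕ) : C.Triple B r DataInv (C.cycle k) DataInv := by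
  refine (triple_prep_ancillas.append ?_).append (triple_meas_ancillas k)
  -- Distinctness of the remaining checks is carried along so that the gates of one check do not
  -- disturb the other ready ancillas.
  refine (Triple.flatMap (I := fun cs V p => cs.Nodup ∧ DataInv V p ∧
    ∀ c ∈ cs, C.Ready B c V p) ?_ _).weaken ?_ ?_
  · rintro c cs l k V p p' hV ⟨hn, h⟩ hr
    obtain ⟨hc, hn'⟩ := List.nodup_cons.mp hn
    by_cases hB : checkType c = B
    · obtain ⟨V', hV', h'⟩ := triple_checkBlock_same hc hB l k V p p' hV h hr
      exact ⟨V', hV', hn', h'⟩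
    · obtain ⟨V', hV', h'⟩ := triple_checkBlock_opposite hc hB l k V p p' hV h hr
      exact ⟨V', hV', hn', h'⟩
  · exact fun V p _ h => ⟨nodup_allChecks, h.1, fun c _ => h.2 c⟩
  · exact fun V p _ h => h.2.1

theorem triple_memory (R : ℕ) : C.Triple B r (fun _ _ => True) (C.memory B R)
    (fun V _ => (fun q => r (.inr q)) ∈ V) := by
  refine (triple_prep_data.append ?_).append triple_meas_data
  exact Triple.flatMap (I := fun _ => DataInv) (fun k _ => triple_cycle k) _

theorem ne_of_cnot_mem_memory {B : Basis} {R : ℕ} {c t : Site n nX nZ}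
    (h : Op.cnot c t ∈ C.memory B R) : c ≠ t := by
  have key (d : Fin nX ⊕ Fin nZ) (q : Fin n) (hd : Op.cnot c t = Code.checkCnot d q) : c ≠ t := by
    unfold checkCnot at hd
    split at hd <;> cases hd <;> simp
  simp only [memory, cycle, checkBlock, List.mem_append, List.mem_map, List.mem_flatMap,
    List.mem_cons, reduceCtorEq, and_false, exists_false, false_or, or_false] at h
  obtain ⟨_, -, d, -, h | ⟨q, -, h⟩⟩ := h
  · exact key d _ h
  · exact key d q h.symm

/-- The final data results are, up to checks, a product of elementary errors, at most one for
each loss. -/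
theorem IsOutcome.mem_errorSpace {B : Basis} {R : ℕ} {l : Finset (ℕ × Site n nX nZ)}
    {r : Label n nX nZ → ZMod 2} (h : C.IsOutcome B R l r) :
    ∃ V, C.IsErrorSpace B l.card V ∧ (fun q => r (.inr q)) ∈ V := by
  obtain ⟨x, p', -, hr⟩ := exists_run_of_canYield B _ (fun _ _ => ne_of_cnot_mem_memory) _ _ _ h
  -- No loss precedes operation 0, so the error space starts as the bare `gauge B`.
  obtain ⟨V, ⟨W, h1, h2⟩, hm⟩ := triple_memory R l 0 (C.gauge B) _ _
    ⟨∅, by simp, by simp, by simp⟩ trivial hr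
  exact ⟨V, ⟨W, h1.trans (Finset.card_le_card (Finset.filter_subset _ _)), h2⟩, hm⟩

end Code

namespace Code

variable {n nX nZ : ℕ} {C : Code n nX nZ} {B : Basis}

/-! ### Decoding -/

theorem eq_other_iff {B' : Basis} : B' = B.other ↔ B' ≠ B := by
  cases B <;> cases B' <;> simp [Basis.other]

theorem gauge_eq : C.gauge B =
    Submodule.span (ZMod 2) {w | ∃ c, checkType c = B.other ∧ w = pauliVec (C.support c)} := by
  simp only [gauge, eq_other_iff]

theorem toleratesHooks_zero : C.ToleratesHooks 0 := fun _ _ _ _ h => absurd h (Nat.not_lt_zero _)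

theorem toleratesHooks_one : C.ToleratesHooks 1 := by
  intro B hooks paulis _ h hl
  rw [Nat.lt_one_iff, Nat.add_eq_zero_iff, List.length_eq_zero_iff, List.length_eq_zero_iff] at h
  obtain ⟨rfl, rfl⟩ := h
  apply hl.2
  simp [pauliVec]

theorem ToleratesHooks.mono {d d' : ℕ} (h : C.ToleratesHooks d) (hd : d' ≤ d) :
    C.ToleratesHooks d' :=
  fun B hooks paulis ht hl => h B hooks paulis ht (hl.trans_le hd)

/-- For positive distance `d`, `2 * ((d - 1) / 2) + 1 ≤ d`. For distance 0 the claim is tolerance 1,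
which always holds because the empty product is a product of checks. -/
theorem toleratesHooks_of_hookDistance :
    C.ToleratesHooks (2 * ((C.hookDistance - 1) / 2) + 1) := by
  rcases Nat.eq_zero_or_pos C.hookDistance with h | h
  · rw [h]; exact toleratesHooks_one
  · have hb : BddAbove {d | C.ToleratesHooks d} := by
      -- The supremum of an unbounded set of naturals is 0 by default, so a positive distance is
      -- attained.
      by_contra hb
      rw [hookDistance, csSup_of_not_bddAbove hb] at h
      simp at h
    exact ToleratesHooks.mono (Nat.sSup_mem ⟨0, toleratesHooks_zero⟩ hb)
      (by change _ ≤ C.hookDistance; omega)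

/-- A sum of elementary errors is a product of as many hook errors and Pauli errors. -/
theorem exists_hooks_paulis (U : Finset (Fin n → ZMod 2)) (hU : ∀ w ∈ U, C.IsElementary B w) :
    ∃ (hooks : List ((Fin nX ⊕ Fin nZ) × ℕ)) (paulis : List (Fin n)),
      (∀ h ∈ hooks, checkType h.1 ≠ B) ∧ hooks.length + paulis.length = U.card ∧
      (hooks.map fun h => C.hook h.1 h.2).sum + pauliVec paulis = ∑ w ∈ U, w := by
  induction U using Finset.induction_on with
  | empty => exact ⟨[], [], by simp, by simp, by simp [pauliVec]⟩
  | insert w U hw ih =>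
    obtain ⟨hooks, paulis, h1, h2, h3⟩ := ih fun w hw => hU w (Finset.mem_insert_of_mem hw)
    rw [Finset.card_insert_of_notMem hw, Finset.sum_insert hw, ← h2, ← h3]
    rcases hU w (Finset.mem_insert_self _ _) with ⟨q, rfl⟩ | ⟨c, t, hc, rfl⟩
    · refine ⟨hooks, q :: paulis, h1, by simp; omega, ?_⟩
      simp only [pauliVec, List.map_cons, List.sum_cons]
      abel
    · refine ⟨(c, t) :: hooks, paulis, ?_, by simp; omega, ?_⟩
      · intro h hh
        rcases List.mem_cons.mp hh with rfl | hh
        · exact hc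
        · exact h1 h hh
      · simp only [List.map_cons, List.sum_cons]
        abel

/-- Over the field with two elements, spans consist of subset sums. -/
theorem exists_subset_sum_eq {W : Finset (Fin n → ZMod 2)} {v : Fin n → ZMod 2}
    (h : v ∈ Submodule.span (ZMod 2) (W : Set (Fin n → ZMod 2))) : ∃ U ⊆ W, ∑ w ∈ U, w = v := by
  obtain ⟨f, -, rfl⟩ := Submodule.mem_span_finset.mp h
  refine ⟨W.filter fun w => f w = 1, Finset.filter_subset _ _, ?_⟩
  rw [Finset.sum_filter]
  refine Finset.sum_congr rfl fun w _ => ?_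
  rcases zmod_two_cases (f w) with h | h <;> simp [h]

theorem IsErrorSpace.sup {m m' : ℕ} {V V' : Submodule (ZMod 2) (Fin n → ZMod 2)}
    (h : C.IsErrorSpace B m V) (h' : C.IsErrorSpace B m' V') :
    C.IsErrorSpace B (m + m') (V ⊔ V') := by
  obtain ⟨W, h1, h2, rfl⟩ := h
  obtain ⟨W', h1', h2', rfl⟩ := h'
  refine ⟨W ∪ W', (Finset.card_union_le _ _).trans (add_le_add h1 h1'), ?_, ?_⟩
  · exact fun w hw => (Finset.mem_union.mp hw).elim (h2 w) (h2' w)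
  · rw [Finset.coe_union, Submodule.span_union, sup_sup_sup_comm, sup_idem]

/-- Undetected errors in an error space of few elementary errors are products of checks. -/
theorem ToleratesHooks.mem_gauge {d m : ℕ} (h : C.ToleratesHooks d) (hm : m < d)
    {V : Submodule (ZMod 2) (Fin n → ZMod 2)} (hV : C.IsErrorSpace B m V) {e : Fin n → ZMod 2}
    (he : e ∈ V) (hc : ∀ c, checkType c = B → pauliVec (C.support c) ⬝ᵥ e = 0)
    (hg : ∀ g ∈ C.gauge B, ∀ c, checkType c = B → pauliVec (C.support c) ⬝ᵥ g = 0) :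
    e ∈ C.gauge B := by
  obtain ⟨W, h1, h2, rfl⟩ := hV
  obtain ⟨y, hy, g, hgm, rfl⟩ := Submodule.mem_sup.mp he
  obtain ⟨U, hU, rfl⟩ := exists_subset_sum_eq hy
  obtain ⟨hooks, paulis, h3, h4, h5⟩ := exists_hooks_paulis U fun w hw => h2 w (hU hw)
  refine ((C.gauge B).add_mem_iff_left hgm).mpr ?_
  by_contra hn
  refine h B.other hooks paulis (fun a ha => eq_other_iff.mpr (h3 a ha)) ?_ ⟨fun c hcB => ?_, ?_⟩
  · rw [h4]
    exact ((Finset.card_le_card hU).trans h1).trans_lt hm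
  · have hcB' : checkType c = B := by
      by_contra h0; exact hcB (eq_other_iff.mpr h0)
    have := hc c hcB'
    rwa [dotProduct_add, hg g hgm c hcB', add_zero, ← h5] at this
  · rw [h5, ← gauge_eq]
    exact hn

theorem dotProduct_eq_zero_of_mem_gauge {v g : Fin n → ZMod 2} (hv : C.IsLogical B v)
    (hg : g ∈ C.gauge B) : v ⬝ᵥ g = 0 := by
  induction hg using Submodule.span_induction with
  | mem w hw =>
    obtain ⟨c, hc, rfl⟩ := hw
    rw [dotProduct_comm]
    exact hv c hc
  | zero => exact dotProduct_zero v
  | add x y _ _ hx hy => rw [dotProduct_add, hx, hy, add_zero]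
  | smul a x _ hx => rw [dotProduct_smul, hx, smul_zero]

/-- Checks are logical operators. -/
theorem isLogical_support {c : Fin nX ⊕ Fin nZ} (hc : checkType c = B) :
    C.IsLogical B (pauliVec (C.support c)) := by
  subst hc
  intro c' hc'
  rcases c with i | j <;> rcases c' with i' | j'
  · exact absurd rfl hc'
  · rw [dotProduct_comm]; exact C.commute i j'
  · exact C.commute i' j
  · exact absurd rfl hc'

theorem pauliVec_dotProduct (L : List (Fin n)) (e : Fin n → ZMod 2) :
    pauliVec L ⬝ᵥ e = (L.map e).sum := by
  induction L with
  | nil => simp [pauliVec]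
  | cons q L ih =>
    have : pauliVec (q :: L) = Pi.single q 1 + pauliVec L := by simp [pauliVec]
    rw [this, add_dotProduct, ih, single_one_dotProduct, List.map_cons, List.sum_cons]

/-- The detectors determine all values of a check of type `B`. -/
theorem checkValue_eq_of_detectors_eq {R : ℕ} {r r' : Label n nX nZ → ZMod 2}
    (h : C.detectors B R r = C.detectors B R r') {c : Fin nX ⊕ Fin nZ} (hc : checkType c = B) :
    ∀ k ≤ R + 1, C.checkValue R r c k = C.checkValue R r' c k := by
  intro k
  induction k with
  | zero => intro _; rfl
  | succ k ih =>
    intro hk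
    have h1 := congrFun (congrFun h c) k
    rw [detectors, detectors, if_pos (Or.inl ⟨hc, by omega⟩), if_pos (Or.inl ⟨hc, by omega⟩),
      ih (by omega)] at h1
    exact add_left_cancel h1

theorem observables_eq {R t : ℕ} (ht : C.ToleratesHooks (2 * t + 1))
    {l l' : Finset (ℕ × Site n nX nZ)} (hl : l.card ≤ t) (hl' : l'.card ≤ t)
    {r r' : Label n nX nZ → ZMod 2} (hr : C.IsOutcome B R l r) (hr' : C.IsOutcome B R l' r')
    (h : C.detectors B R r = C.detectors B R r') : C.observables B r = C.observables B r' := by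
  obtain ⟨V, hV, he⟩ := hr.mem_errorSpace
  obtain ⟨V', hV', he'⟩ := hr'.mem_errorSpace
  have key := ht.mem_gauge (by omega) (hV.sup hV')
    (Submodule.sub_mem _ (Submodule.mem_sup_left he) (Submodule.mem_sup_right he'))
    (fun c hc => ?_) (fun g hg c hc => dotProduct_eq_zero_of_mem_gauge (isLogical_support hc) hg)
  · funext v
    have := dotProduct_eq_zero_of_mem_gauge v.2 key
    rwa [dotProduct_sub, sub_eq_zero] at this
  · have := checkValue_eq_of_detectors_eq h hc (R + 1) le_rfl
    simp only [checkValue, lt_irrefl, if_false] at this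
    rw [dotProduct_sub, sub_eq_zero, pauliVec_dotProduct, pauliVec_dotProduct]
    exact this

end Code

end MidSwap

end

theorem mainTheorem12 {n nX nZ : ℕ} (C : MidSwap.Code n nX nZ) :
    C.CorrectsLosses ((C.hookDistance - 1) / 2) := by
  intro B R
  -- The decoder answers with the observables of some allowed outcome having these detectors. Its
  -- value 0 on impossible patterns never matters.
  refine ⟨fun D => if h : ∃ r l, l.card ≤ (C.hookDistance - 1) / 2 ∧ C.IsOutcome B R l r ∧
    C.detectors B R r = D then C.observables B h.choose else 0, fun l hl r hr => ?_⟩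
  have h : ∃ r' l', l'.card ≤ (C.hookDistance - 1) / 2 ∧ C.IsOutcome B R l' r' ∧
    C.detectors B R r' = C.detectors B R r := ⟨r, l, hl, hr, rfl⟩
  dsimp only
  rw [dif_pos h]
  obtain ⟨l', hl', hr', hd⟩ := h.choose_spec
  exact MidSwap.Code.observables_eq MidSwap.Code.toleratesHooks_of_hookDistance hl' hl hr' hr hd
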